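/- Let $X$ be the Chamanara surface: take the closed unit square with lower left corner at the origin and, for $n = 1, 2, \ldots$, divide its left side (from bottom to top) and its right side (from top to bottom) into segments $a_1, a_2, \ldots$, and its bottom side (from left to right) and its top side (from right to left) into segments $b_1, b_2, \ldots$, where $a_n$ and $b_n$ have length $2^{-n}$; remove the end points of all segments and the four corners, and glue, for each $n$, the two copies of $a_n$ and the two copies of $b_n$ by translations. The planar charts that are locally translations on the square form a translation atlas $\mathcal{U}$ on $X$. Every covering $p \colon Y \to X$ is equipped with the translation atlas $p^*\mathcal{U}$. For a connected translation surface $S$, let $\mathrm{Aff}(S)$ be the group of diffeomorphisms of $S$ that are affine on charts, let $D \colon \mathrm{Aff}(S) \to \mathrm{GL}(2, \mathbb{R})$ be the derivative map, and let $\Gamma(S)$ (the Veech group) be the image and $\mathrm{Trans}(S)$ (the translation group) the kernel of $D$. Then: 1. For every covering $p \colon Y \to X$ with $Y$ connected, every $f \in \mathrm{Aff}(Y)$ descends to $X$, i.e., there is $g \in \mathrm{Aff}(X)$ with $p \circ f = g \circ p$. In particular, $\Gamma(Y) \subseteq \Gamma(X)$. 2. For the universal covering $q \colon \widetilde{X}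 \to X$, the translations of $\widetilde{X}$ are exactly the deck transformations: $\mathrm{Trans}(\widetilde{X}) = \mathrm{Deck}(\widetilde{X}/X)$. -/

import Mathlib

open Set Filter Topology

noncomputable section

/-! ### Translation surfaces and their affine groups -/

/-- The plane `ℝ²`; only its topology and its affine structure are used. -/
abbrev Plane := Fin 2 → ℝ

/-- A translation atlas on a topological space: planar charts that cover the space and whose
transition maps are locally translations. -/
structure TranslationAtlas (S : Type*) [TopologicalSpace S] where
  charts : Set (OpenPartialHomeomorph S Plane)
  exists_chart : ∀ x, ∃ φ ∈ charts, x ∈ φ.source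
  transition : ∀ φ ∈ charts, ∀ ψ ∈ charts, ∀ x, x ∈ φ.source → x ∈ ψ.source →
    ∃ c : Plane, ∀ᶠ y in 𝓝 x, ψ y = φ y + c

namespace TranslationAtlas

variable {S : Type*} [TopologicalSpace S] (𝒜 : TranslationAtlas S)

/-- In the charts of `𝒜`, the map `f` is locally of the form `v ↦ A v + c`, with the same
linear part `A` everywhere. -/
def HasDerivative (f : S → S) (A : Matrix (Fin 2) (Fin 2) ℝ) : Prop :=
  ∀ φ ∈ 𝒜.charts, ∀ ψ ∈ 𝒜.charts, ∀ x, x ∈ φ.source → f x ∈ ψ.source →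
    ∃ c : Plane, ∀ᶠ y in 𝓝 x, ψ (f y) = A.mulVec (φ y) + c

variable {𝒜}

theorem hasDerivative_one : 𝒜.HasDerivative (1 : S ≃ₜ S) 1 := by
  intro φ hφ ψ hψ x hx hx'
  simpa using 𝒜.transition φ hφ ψ hψ x hx hx'

theorem HasDerivative.mul {f g : S ≃ₜ S} {A B : Matrix (Fin 2) (Fin 2) ℝ}
    (hf : 𝒜.HasDerivative f A) (hg : 𝒜.HasDerivative g B) :
    𝒜.HasDerivative (f * g : S ≃ₜ S) (A * B) := by
  intro φ hφ ψ hψ x hx hx'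
  obtain ⟨χ, hχ, hgx⟩ := 𝒜.exists_chart (g x)
  obtain ⟨c, hc⟩ := hg φ hφ χ hχ x hx hgx
  obtain ⟨d, hd⟩ := hf χ hχ ψ hψ (g x) hgx hx'
  refine ⟨A.mulVec c + d, ?_⟩
  filter_upwards [hc, g.continuous.continuousAt.eventually hd] with y h1 h2
  rw [Homeomorph.mul_apply, h2, h1, Matrix.mulVec_add, Matrix.mulVec_mulVec, add_assoc]

theorem HasDerivative.inv {f : S ≃ₜ S} {A : GL (Fin 2) ℝ}
    (hf : 𝒜.HasDerivative f (A : Matrix (Fin 2) (Fin 2) ℝ)) :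
    𝒜.HasDerivative (f⁻¹ : S ≃ₜ S) ((A⁻¹ : GL (Fin 2) ℝ) : Matrix (Fin 2) (Fin 2) ℝ) := by
  intro φ hφ ψ hψ x hx hx'
  have hfx : f ((f⁻¹ : S ≃ₜ S) x) = x := f.apply_symm_apply x
  obtain ⟨c, hc⟩ := hf ψ hψ φ hφ ((f⁻¹ : S ≃ₜ S) x) hx' (by rwa [hfx])
  refine ⟨-((A⁻¹ : GL (Fin 2) ℝ) : Matrix (Fin 2) (Fin 2) ℝ).mulVec c, ?_⟩
  filter_upwards [(f⁻¹ : S ≃ₜ S).continuous.continuousAt.eventually hc] with y h1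
  have hfy : f ((f⁻¹ : S ≃ₜ S) y) = y := f.apply_symm_apply y
  rw [hfy] at h1
  rw [h1, Matrix.mulVec_add, Matrix.mulVec_mulVec, Units.inv_mul, Matrix.one_mulVec,
    add_neg_cancel_right]

variable (𝒜)

/-- The affine group `Aff(S)`: homeomorphisms of `S` that are affine on charts, with an
invertible linear part (these are automatically diffeomorphisms). -/
def aff : Subgroup (S ≃ₜ S) where
  carrier := {f | ∃ A : GL (Fin 2) ℝ, 𝒜.HasDerivative f A}
  one_mem' := ⟨1, hasDerivative_one⟩
  mul_mem' := by
    rintro f g ⟨A, hA⟩ ⟨B, hB⟩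
    exact ⟨A * B, hA.mul hB⟩
  inv_mem' := by
    rintro f ⟨A, hA⟩
    exact ⟨A⁻¹, hA.inv⟩

/-- The translation group `Trans(S)`: the homeomorphisms that are translations on charts. -/
def trans : Subgroup (S ≃ₜ S) where
  carrier := {f | 𝒜.HasDerivative f 1}
  one_mem' := hasDerivative_one
  mul_mem' := by
    intro f g hf hg
    simpa using HasDerivative.mul hf hg
  inv_mem' := by
    intro f hf
    have := HasDerivative.inv (𝒜 := 𝒜) (f := f) (A := 1) hf
    simpa using this

/-- The Veech group `Γ(S)`: the derivatives of the elements of the affine group. -/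
def veechGroup : Subgroup (GL (Fin 2) ℝ) where
  carrier := {A | ∃ f : S ≃ₜ S, 𝒜.HasDerivative f A}
  one_mem' := ⟨1, hasDerivative_one⟩
  mul_mem' := by
    rintro A B ⟨f, hf⟩ ⟨g, hg⟩
    exact ⟨f * g, hf.mul hg⟩
  inv_mem' := by
    rintro A ⟨f, hf⟩
    exact ⟨f⁻¹, hf.inv⟩

/-- The atlas `p^* 𝒜` on a space over `S`, for a local homeomorphism (for instance a covering)
`p`: its charts are the maps `φ ∘ p`, for a chart `φ` of `𝒜`, on open sets on which `p`
is a homeomorphism onto an open set. -/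
def pullback {T : Type*} [TopologicalSpace T] {p : T → S} (hp : IsLocalHomeomorph p) :
    TranslationAtlas T where
  charts := {χ | ∃ e : OpenPartialHomeomorph T S, ∃ φ ∈ 𝒜.charts, p = e ∧ χ = e.trans φ}
  exists_chart := by
    intro x
    obtain ⟨e, hx, he⟩ := hp x
    obtain ⟨φ, hφ, hpx⟩ := 𝒜.exists_chart (p x)
    refine ⟨e.trans φ, ⟨e, φ, hφ, he, rfl⟩, ?_⟩
    rw [OpenPartialHomeomorph.trans_source]
    exact ⟨hx, by rw [mem_preimage, ← he]; exact hpx⟩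
  transition := by
    rintro _ ⟨e, φ, hφ, he, rfl⟩ _ ⟨e', φ', hφ', he', rfl⟩ x hx hx'
    rw [OpenPartialHomeomorph.trans_source] at hx hx'
    have h1 : p x ∈ φ.source := by have := hx.2; rwa [mem_preimage, ← he] at this
    have h2 : p x ∈ φ'.source := by have := hx'.2; rwa [mem_preimage, ← he'] at this
    obtain ⟨c, hc⟩ := 𝒜.transition φ hφ φ' hφ' (p x) h1 h2
    refine ⟨c, ?_⟩
    filter_upwards [hp.continuous.continuousAt.eventually hc] with y hy
    rw [OpenPartialHomeomorph.trans_apply, OpenPartialHomeomorph.trans_apply, ← he, ← he']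
    exact hy

end TranslationAtlas

/-- The group of deck transformations of `p : T → S`. -/
def deckGroup {T S : Type*} [TopologicalSpace T] (p : T → S) : Subgroup (T ≃ₜ T) where
  carrier := {t | ∀ y, p (t y) = p y}
  one_mem' := fun _ => rfl
  mul_mem' := by
    intro s t hs ht y
    rw [Homeomorph.mul_apply, hs, ht]
  inv_mem' := by
    intro t ht y
    have := ht ((t⁻¹ : T ≃ₜ T) y)
    rw [Homeomorph.inv_apply, t.apply_symm_apply] at this
    rw [Homeomorph.inv_apply, this]

/-! ### The Chamanara surface

The unit square with its boundary cut into segments. For `i = 0` the segments lie on the left and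
right sides (these are the segments `a₁, a₂, …`), for `i = 1` on the bottom and top sides
(these are `b₁, b₂, …`); the segment with index `n : ℕ` has length `1 / 2 ^ (n + 1)`.
The remaining coordinate is `1 - i`. All segments are open: the end points and the corners are not
part of the surface. -/

namespace Chamanara

/-- The segment of length `1 / 2 ^ (n + 1)` on the left side (`i = 0`) or the bottom side
(`i = 1`); the lengths decrease away from the origin. -/
def startEdge (i : Fin 2) (n : ℕ) : Set Plane :=
  {z | z i = 0 ∧ z (1 - i) ∈ Ioo (1 - 1 / 2 ^ n : ℝ) (1 - 1 / 2 ^ (n + 1))}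

/-- The segment of length `1 / 2 ^ (n + 1)` on the right side (`i = 0`) or the top side
(`i = 1`); the lengths decrease away from the corner `(1, 1)`. -/
def endEdge (i : Fin 2) (n : ℕ) : Set Plane :=
  {z | z i = 1 ∧ z (1 - i) ∈ Ioo (1 / 2 ^ (n + 1) : ℝ) (1 / 2 ^ n)}

/-- The translation vector that takes `startEdge i n` to `endEdge i n`. -/
def shift (i : Fin 2) (n : ℕ) : Plane :=
  fun j => if j = i then 1 else 3 / 2 ^ (n + 1) - 1

/-- The open unit square. -/
def openSquare : Set Plane := {z | ∀ j, z j ∈ Ioo (0 : ℝ) 1}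

/-- The unit square without the end points of the boundary segments and without the corners. -/
def polygon : Set Plane := openSquare ∪ ⋃ i, ⋃ n, (startEdge i n ∪ endEdge i n)

/-- Two boundary points are glued when they correspond under the translation from a segment to
the segment of the same length on the opposite side. -/
def Glue (z w : polygon) : Prop :=
  ∃ i n, (z : Plane) ∈ startEdge i n ∧ (w : Plane) = z + shift i n

end Chamanara

/-- The Chamanara surface (without its singularity), with the quotient topology. -/
def Chamanara : Type := Quot Chamanara.Glue

namespace Chamanara

instance : TopologicalSpace Chamanara :=
  inferInstanceAs (TopologicalSpace (Quot Glue))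

/-- The projection of the polygon onto the surface. -/
def mk (z : polygon) : Chamanara := Quot.mk Glue z

/-- The planar charts of the surface that are compatible with the polygon: those which, read on
the polygon, are locally translations. -/
def charts : Set (OpenPartialHomeomorph Chamanara Plane) :=
  {φ | ∀ z : polygon, mk z ∈ φ.source →
    ∃ c : Plane, ∀ᶠ w : polygon in 𝓝 z, φ (mk w) = (w : Plane) + c}

theorem continuous_mk : Continuous mk := continuous_quot_mk

theorem isOpen_iff {U : Set Chamanara} : IsOpen U ↔ IsOpen (mk ⁻¹' U) :=
  isQuotientMap_quot_mk.isOpen_preimage.symm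

theorem charts_transition (φ : OpenPartialHomeomorph Chamanara Plane) (hφ : φ ∈ charts)
    (ψ : OpenPartialHomeomorph Chamanara Plane) (hψ : ψ ∈ charts) (x : Chamanara)
    (hx : x ∈ φ.source) (hx' : x ∈ ψ.source) :
    ∃ c : Plane, ∀ᶠ y in 𝓝 x, ψ y = φ y + c := by
  refine ⟨ψ x - φ x, ?_⟩
  have hopen : IsOpen {y | (y ∈ φ.source ∧ y ∈ ψ.source) ∧ ψ y = φ y + (ψ x - φ x)} := by
    rw [isOpen_iff, isOpen_iff_mem_nhds]
    rintro z ⟨⟨h1, h2⟩, h3⟩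
    obtain ⟨c, hc⟩ := hφ z h1
    obtain ⟨d, hd⟩ := hψ z h2
    have h1' := continuous_mk.continuousAt.eventually (φ.open_source.mem_nhds h1)
    have h2' := continuous_mk.continuousAt.eventually (ψ.open_source.mem_nhds h2)
    have e1 := hc.self_of_nhds
    have e2 := hd.self_of_nhds
    filter_upwards [hc, hd, h1', h2'] with w a b a' b'
    refine ⟨⟨a', b'⟩, ?_⟩
    rw [a, b]
    rw [e1, e2] at h3
    have : d = c + (ψ x - φ x) := by
      rw [add_assoc] at h3
      exact add_left_cancel h3
    rw [this, add_assoc]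
  filter_upwards [hopen.mem_nhds ⟨⟨hx, hx'⟩, by abel⟩] with y hy using hy.2

theorem one_sub_ne (i : Fin 2) : 1 - i ≠ i := by revert i; decide

theorem eq_or_eq (i j : Fin 2) : j = i ∨ j = 1 - i := by revert i j; decide

theorem shift_self (i : Fin 2) (n : ℕ) : shift i n i = 1 := by simp [shift]

theorem shift_other (i : Fin 2) (n : ℕ) : shift i n (1 - i) = 3 / 2 ^ (n + 1) - 1 := by
  simp [shift, one_sub_ne]

theorem plane_ext (i : Fin 2) {z w : Plane} (h : z i = w i) (h' : z (1 - i) = w (1 - i)) :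
    z = w := by
  funext j
  rcases eq_or_eq i j with rfl | rfl
  · exact h
  · exact h'

theorem mem_openSquare (i : Fin 2) {z : Plane} :
    z ∈ openSquare ↔ z i ∈ Ioo (0 : ℝ) 1 ∧ z (1 - i) ∈ Ioo (0 : ℝ) 1 := by
  constructor
  · intro h
    exact ⟨h _, h _⟩
  · rintro ⟨h, h'⟩ j
    rcases eq_or_eq i j with rfl | rfl
    · exact h
    · exact h'

theorem pow_facts (n : ℕ) : (0 : ℝ) < 1 / 2 ^ (n + 1) ∧ (1 : ℝ) / 2 ^ n = 2 * (1 / 2 ^ (n + 1)) ∧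
    (1 : ℝ) / 2 ^ n ≤ 1 ∧ (3 : ℝ) / 2 ^ (n + 1) = 3 * (1 / 2 ^ (n + 1)) := by
  refine ⟨by positivity, by rw [pow_succ]; field_simp, ?_, by ring⟩
  rw [div_le_one (by positivity)]
  exact one_le_pow₀ (by norm_num)

theorem startEdge_add_shift {i : Fin 2} {n : ℕ} {z : Plane} (hz : z ∈ startEdge i n) :
    z + shift i n ∈ endEdge i n := by
  obtain ⟨h0, h1, h2⟩ := hz
  obtain ⟨p0, p1, p2, p3⟩ := pow_facts n
  refine ⟨by simp [h0, shift_self], ?_, ?_⟩ <;>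
  · rw [Pi.add_apply, shift_other]
    linarith

theorem startEdge_subset (i : Fin 2) (n : ℕ) : startEdge i n ⊆ polygon := fun _ hz =>
  Or.inr (mem_iUnion.2 ⟨i, mem_iUnion.2 ⟨n, Or.inl hz⟩⟩)

theorem endEdge_subset (i : Fin 2) (n : ℕ) : endEdge i n ⊆ polygon := fun _ hz =>
  Or.inr (mem_iUnion.2 ⟨i, mem_iUnion.2 ⟨n, Or.inr hz⟩⟩)

theorem mem_startEdge_bounds {i : Fin 2} {n : ℕ} {z : Plane} (hz : z ∈ startEdge i n) :
    z i = 0 ∧ z (1 - i) ∈ Ioo (0 : ℝ) 1 := by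
  obtain ⟨h0, h1, h2⟩ := hz
  obtain ⟨p0, p1, p2, p3⟩ := pow_facts n
  exact ⟨h0, by linarith, by linarith⟩

theorem mem_endEdge_bounds {i : Fin 2} {n : ℕ} {z : Plane} (hz : z ∈ endEdge i n) :
    z i = 1 ∧ z (1 - i) ∈ Ioo (0 : ℝ) 1 := by
  obtain ⟨h0, h1, h2⟩ := hz
  obtain ⟨p0, p1, p2, p3⟩ := pow_facts n
  exact ⟨h0, by linarith, by linarith⟩

theorem polygon_bounds {z : Plane} (hz : z ∈ polygon) (j : Fin 2) : 0 ≤ z j ∧ z j ≤ 1 := by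
  rcases hz with hz | hz
  · exact ⟨(hz j).1.le, (hz j).2.le⟩
  · obtain ⟨i, hz⟩ := mem_iUnion.1 hz
    obtain ⟨n, hz | hz⟩ := mem_iUnion.1 hz
    · obtain ⟨h, h1, h2⟩ := mem_startEdge_bounds hz
      rcases eq_or_eq i j with rfl | rfl
      · simp [h]
      · exact ⟨h1.le, h2.le⟩
    · obtain ⟨h, h1, h2⟩ := mem_endEdge_bounds hz
      rcases eq_or_eq i j with rfl | rfl
      · simp [h]
      · exact ⟨h1.le, h2.le⟩

open Classical in
/-- The projection of the polygon onto the surface, extended to the plane by a junk value. -/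
def mk' (w : Plane) : Chamanara :=
  if h : w ∈ polygon then mk ⟨w, h⟩ else mk ⟨fun _ => 1 / 2, Or.inl fun _ => by norm_num⟩

theorem mk'_of_mem {w : Plane} (h : w ∈ polygon) : mk' w = mk ⟨w, h⟩ := dif_pos h

theorem continuousOn_mk' : ContinuousOn mk' polygon := by
  rw [continuousOn_iff_continuous_domRestrict]
  convert continuous_mk using 1
  funext z
  exact mk'_of_mem z.2

/-- A way to build charts: `E` is the saturated open part of the polygon over the source of the
chart, `F` is the chart read on the polygon, and `G` is its inverse. -/
theorem exists_chart_of (E : Set polygon) (R : Set Plane) (F : polygon → Plane)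
    (G : Plane → Chamanara) (hE : IsOpen E) (hR : IsOpen R)
    (hsat : ∀ z w, Glue z w → (z ∈ E ↔ w ∈ E))
    (hF : ∀ z w, Glue z w → z ∈ E → F z = F w)
    (hFE : ∀ z ∈ E, ∃ c : Plane, ∀ᶠ w : polygon in 𝓝 z, F w = (w : Plane) + c)
    (hFR : ∀ z ∈ E, F z ∈ R) (hG : ContinuousOn G R)
    (hGF : ∀ z ∈ E, G (F z) = mk z)
    (hFG : ∀ v ∈ R, ∃ z ∈ E, G v = mk z ∧ F z = v) :
    ∃ φ ∈ charts, ∀ z ∈ E, mk z ∈ φ.source := by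
  classical
  let E' : Chamanara → Prop := Quot.lift (fun z => z ∈ E) fun z w h => propext (hsat z w h)
  let F' : Chamanara → Plane := Quot.lift (fun z => if z ∈ E then F z else 0) fun z w h => by
    by_cases hz : z ∈ E
    · simp [hz, (hsat z w h).1 hz, hF z w h hz]
    · have : w ∉ E := fun hw => hz ((hsat z w h).2 hw)
      simp [hz, this]
  have hF' : ∀ z ∈ E, F' (mk z) = F z := fun z hz => if_pos hz
  have hopen : IsOpen {x | E' x} := by rw [isOpen_iff]; exact hE
  have hloc : ∀ z ∈ E, ∃ c : Plane, ∀ᶠ w : polygon in 𝓝 z, F' (mk w) = (w : Plane) + c := by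
    intro z hz
    obtain ⟨c, hc⟩ := hFE z hz
    refine ⟨c, ?_⟩
    filter_upwards [hc, hE.mem_nhds hz] with w hw hwE
    rw [hF' w hwE, hw]
  let φ : OpenPartialHomeomorph Chamanara Plane :=
    { toFun := F'
      invFun := G
      source := {x | E' x}
      target := R
      map_source' := by
        rintro ⟨z⟩ hz
        change F' (mk z) ∈ R
        rw [hF' z hz]
        exact hFR z hz
      map_target' := by
        intro v hv
        obtain ⟨z, hz, h, -⟩ := hFG v hv
        rw [h]
        exact hz
      left_inv' := by
        rintro ⟨z⟩ hz
        change G (F' (mk z)) = mk z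
        rw [hF' z hz, hGF z hz]
      right_inv' := by
        intro v hv
        obtain ⟨z, hz, h, h'⟩ := hFG v hv
        rw [h, hF' z hz, h']
      open_source := hopen
      open_target := hR
      continuousOn_toFun := by
        rw [continuousOn_open_iff hopen]
        intro V hV
        rw [isOpen_iff, isOpen_iff_mem_nhds]
        rintro z ⟨hz, hzV⟩
        obtain ⟨c, hc⟩ := hloc z hz
        have hcont : ContinuousAt (fun w : polygon => (w : Plane) + c) z := by fun_prop
        have hzV' : (z : Plane) + c ∈ V := by rw [← hc.self_of_nhds]; exact hzV
        filter_upwards [hE.mem_nhds hz, hc, hcont.eventually (hV.mem_nhds hzV')] with w h1 h2 h3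
        refine ⟨h1, ?_⟩
        change F' (mk w) ∈ V
        rw [h2]
        exact h3
      continuousOn_invFun := hG }
  exact ⟨φ, fun z hz => hloc z hz, fun z hz => hz⟩

theorem not_mem_openSquare_of_glue {z w : polygon} (h : Glue z w) :
    (z : Plane) ∉ openSquare ∧ (w : Plane) ∉ openSquare := by
  obtain ⟨i, n, hz, hw⟩ := h
  have hw' : (w : Plane) ∈ endEdge i n := hw ▸ startEdge_add_shift hz
  refine ⟨fun h => ?_, fun h => ?_⟩
  · exact (h i).1.ne' hz.1
  · exact (h i).2.ne hw'.1

theorem isOpen_openSquare : IsOpen openSquare := by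
  have : openSquare = ⋂ j : Fin 2, (fun z : Plane => z j) ⁻¹' Ioo 0 1 := by
    ext z; simp [openSquare]
  rw [this]
  exact isOpen_iInter_of_finite fun j => isOpen_Ioo.preimage (continuous_apply j)

theorem exists_chart_openSquare :
    ∃ φ ∈ charts, ∀ z : polygon, (z : Plane) ∈ openSquare → mk z ∈ φ.source := by
  refine exists_chart_of {z | (z : Plane) ∈ openSquare} openSquare (fun z => z) mk'
    (isOpen_openSquare.preimage continuous_subtype_val) isOpen_openSquare ?_ ?_ ?_ ?_ ?_ ?_ ?_
  · intro z w h
    have := not_mem_openSquare_of_glue h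
    exact ⟨fun h => absurd h this.1, fun h => absurd h this.2⟩
  · intro z w h hz
    exact absurd hz (not_mem_openSquare_of_glue h).1
  · intro z _
    exact ⟨0, Eventually.of_forall fun w => (add_zero _).symm⟩
  · exact fun z hz => hz
  · exact continuousOn_mk'.mono fun z hz => Or.inl hz
  · exact fun z _ => mk'_of_mem z.2
  · exact fun v hv => ⟨⟨v, Or.inl hv⟩, hv, mk'_of_mem _, rfl⟩

/-- The part of the polygon next to `startEdge i n`. -/
def startPart (i : Fin 2) (n : ℕ) : Set Plane :=
  {z | z i < 1 / 2 ∧ z (1 - i) ∈ Ioo (1 - 1 / 2 ^ n : ℝ) (1 - 1 / 2 ^ (n + 1))}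

/-- The part of the polygon next to `endEdge i n`. -/
def endPart (i : Fin 2) (n : ℕ) : Set Plane :=
  {z | 1 / 2 < z i ∧ z (1 - i) ∈ Ioo (1 / 2 ^ (n + 1) : ℝ) (1 / 2 ^ n)}

theorem isOpen_startPart (i : Fin 2) (n : ℕ) : IsOpen (startPart i n) :=
  (isOpen_lt (continuous_apply i) continuous_const).inter
    (isOpen_Ioo.preimage (continuous_apply (1 - i)))

theorem isOpen_endPart (i : Fin 2) (n : ℕ) : IsOpen (endPart i n) :=
  (isOpen_lt continuous_const (continuous_apply i)).inter
    (isOpen_Ioo.preimage (continuous_apply (1 - i)))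

theorem index_unique {m n : ℕ} {t : ℝ} (hm : t ∈ Ioo (1 / 2 ^ (m + 1) : ℝ) (1 / 2 ^ m))
    (hn : t ∈ Ioo (1 / 2 ^ (n + 1) : ℝ) (1 / 2 ^ n)) : m = n := by
  have key : ∀ {a b : ℕ}, t ∈ Ioo (1 / 2 ^ (a + 1) : ℝ) (1 / 2 ^ a) →
      t ∈ Ioo (1 / 2 ^ (b + 1) : ℝ) (1 / 2 ^ b) → ¬ a < b := by
    intro a b ha hb hab
    have : (1 : ℝ) / 2 ^ b ≤ 1 / 2 ^ (a + 1) :=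
      one_div_le_one_div_of_le (by positivity) (pow_le_pow_right₀ (by norm_num) hab)
    exact absurd (ha.1.trans hb.2) (not_lt.2 this)
  have := key hm hn
  have := key hn hm
  omega

theorem exists_chart_edge (i : Fin 2) (n : ℕ) :
    ∃ φ ∈ charts, ∀ z : polygon, ((z : Plane) ∈ startEdge i n ∨ (z : Plane) ∈ endEdge i n) →
      mk z ∈ φ.source := by
  classical
  obtain ⟨p0, p1, p2, p3⟩ := pow_facts n
  have hdisj : ∀ {z : Plane}, z ∈ endPart i n → z ∉ startPart i n := fun h h' =>
    absurd (h.1.trans h'.1) (lt_irrefl _)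
  -- a point of the polygon in one of the two parts whose normal coordinate is interior or extreme
  have hstart : ∀ {z : Plane}, z ∈ startPart i n → 0 ≤ z i → z ∈ polygon := by
    intro z hz h
    rcases h.eq_or_lt with h | h
    · exact startEdge_subset i n ⟨h.symm, hz.2⟩
    · exact Or.inl ((mem_openSquare i).2 ⟨⟨h, by linarith [hz.1]⟩,
        by linarith [hz.2.1], by linarith [hz.2.2]⟩)
  have hend : ∀ {z : Plane}, z ∈ endPart i n → z i ≤ 1 → z ∈ polygon := by
    intro z hz h
    rcases h.eq_or_lt with h | h
    · exact endEdge_subset i n ⟨h, hz.2⟩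
    · exact Or.inl ((mem_openSquare i).2 ⟨⟨by linarith [hz.1], h⟩,
        by linarith [hz.2.1], by linarith [hz.2.2]⟩)
  -- in the two parts, only the two segments with index `(i, n)` are glued
  have hglue : ∀ z w : polygon, Glue z w →
      ((z : Plane) ∈ startPart i n ∪ endPart i n ∨ (w : Plane) ∈ startPart i n ∪ endPart i n) →
      (z : Plane) ∈ startEdge i n ∧ (w : Plane) = z + shift i n := by
    rintro z w ⟨j, m, hz, hw⟩ h
    have hw' : (w : Plane) ∈ endEdge j m := hw ▸ startEdge_add_shift hz
    have hb : ∀ {v : Plane}, v ∈ startPart i n ∪ endPart i n → v (1 - i) ∈ Ioo (0 : ℝ) 1 := by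
      rintro v (hv | hv)
      · exact ⟨by linarith [hv.2.1], by linarith [hv.2.2]⟩
      · exact ⟨by linarith [hv.2.1], by linarith [hv.2.2]⟩
    rcases eq_or_eq i j with rfl | rfl
    · have hmn : m = n := by
        rcases h with (h | h) | (h | h)
        · have h1 := hz.2
          have h2 := h.2
          refine index_unique (t := 1 - (z : Plane) (1 - j)) ?_ ?_
          · exact ⟨by linarith [h1.2], by linarith [h1.1]⟩
          · exact ⟨by linarith [h2.2], by linarith [h2.1]⟩
        · have := h.1
          rw [hz.1] at this
          norm_num at this
        · have := h.1
          rw [hw'.1] at this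
          norm_num at this
        · exact index_unique hw'.2 h.2
      subst hmn
      exact ⟨hz, hw⟩
    · rcases h with h | h
      · exact absurd hz.1 (hb h).1.ne'
      · exact absurd hw'.1 (hb h).2.ne
  let R : Set Plane := {v | v i ∈ Ioo (1 / 2 : ℝ) (3 / 2) ∧
    v (1 - i) ∈ Ioo (1 / 2 ^ (n + 1) : ℝ) (1 / 2 ^ n)}
  have hR : IsOpen R := (isOpen_Ioo.preimage (continuous_apply i)).inter
    (isOpen_Ioo.preimage (continuous_apply (1 - i)))
  -- translation of a point of `R` back to the start side
  have hback : ∀ v ∈ R, 1 ≤ v i → v - shift i n ∈ startPart i n ∧ 0 ≤ (v - shift i n) i := by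
    rintro v ⟨⟨h1, h2⟩, h3, h4⟩ h
    refine ⟨⟨?_, ?_, ?_⟩, ?_⟩
    · rw [Pi.sub_apply, shift_self]; linarith
    · rw [Pi.sub_apply, shift_other]; linarith
    · rw [Pi.sub_apply, shift_other]; linarith
    · rw [Pi.sub_apply, shift_self]; linarith
  have hmk : ∀ v ∈ R, v i = 1 → mk' v = mk' (v - shift i n) := by
    intro v hv h
    obtain ⟨h1, h2⟩ := hback v hv h.ge
    have h3 : v ∈ polygon := endEdge_subset i n ⟨h, hv.2⟩
    rw [mk'_of_mem h3, mk'_of_mem (hstart h1 h2)]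
    refine (Quot.sound ⟨i, n, ⟨?_, h1.2⟩, ?_⟩).symm
    · change (v - shift i n) i = 0
      rw [Pi.sub_apply, shift_self, h, sub_self]
    · change v = v - shift i n + shift i n
      abel
  have := exists_chart_of {z | (z : Plane) ∈ startPart i n ∪ endPart i n} R
    (fun z => if (z : Plane) ∈ startPart i n then (z : Plane) + shift i n else z)
    (fun v => if v i ≤ 1 then mk' v else mk' (v - shift i n))
    (((isOpen_startPart i n).union (isOpen_endPart i n)).preimage continuous_subtype_val) hR
    ?_ ?_ ?_ ?_ ?_ ?_ ?_
  · obtain ⟨φ, hφ, h⟩ := this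
    refine ⟨φ, hφ, ?_⟩
    rintro z (hz | hz)
    · exact h z (Or.inl ⟨by rw [hz.1]; norm_num, hz.2⟩)
    · exact h z (Or.inr ⟨by rw [hz.1]; norm_num, hz.2⟩)
  · intro z w h
    constructor
    · intro hz
      obtain ⟨h1, h2⟩ := hglue z w h (Or.inl hz)
      have h3 := startEdge_add_shift h1
      rw [← h2] at h3
      exact Or.inr ⟨by rw [h3.1]; norm_num, h3.2⟩
    · intro hw
      obtain ⟨h1, h2⟩ := hglue z w h (Or.inr hw)
      exact Or.inl ⟨by rw [h1.1]; norm_num, h1.2⟩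
  · intro z w h hz
    obtain ⟨h1, h2⟩ := hglue z w h (Or.inl hz)
    have h3 := startEdge_add_shift h1
    rw [← h2] at h3
    have h4 : (z : Plane) ∈ startPart i n := ⟨by rw [h1.1]; norm_num, h1.2⟩
    have h5 : (w : Plane) ∉ startPart i n := hdisj ⟨by rw [h3.1]; norm_num, h3.2⟩
    simp only [if_pos h4, if_neg h5]
    exact h2.symm
  · rintro z (hz | hz)
    · refine ⟨shift i n, ?_⟩
      filter_upwards [((isOpen_startPart i n).preimage continuous_subtype_val).mem_nhds hz]
        with w hw
      exact if_pos hw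
    · refine ⟨0, ?_⟩
      filter_upwards [((isOpen_endPart i n).preimage continuous_subtype_val).mem_nhds hz]
        with w hw
      rw [add_zero]
      exact if_neg (hdisj hw)
  · rintro z (hz | hz)
    · have hz0 := (polygon_bounds z.2 i).1
      simp only [if_pos hz]
      refine ⟨⟨?_, ?_⟩, ?_, ?_⟩
      · rw [Pi.add_apply, shift_self]; linarith
      · rw [Pi.add_apply, shift_self]; linarith [hz.1]
      · rw [Pi.add_apply, shift_other]; linarith [hz.2.1]
      · rw [Pi.add_apply, shift_other]; linarith [hz.2.2]
    · have hz1 := (polygon_bounds z.2 i).2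
      simp only [if_neg (hdisj hz)]
      exact ⟨⟨hz.1, by linarith⟩, hz.2⟩
  · have hc1 : ContinuousOn mk' (R ∩ {v | v i ≤ 1}) :=
      continuousOn_mk'.mono fun v hv => hend ⟨hv.1.1.1, hv.1.2⟩ hv.2
    have hc2 : ContinuousOn (fun v => mk' (v - shift i n)) (R ∩ {v | 1 ≤ v i}) := by
      refine continuousOn_mk'.comp (by fun_prop) ?_
      intro v hv
      obtain ⟨h1, h2⟩ := hback v hv.1 hv.2
      exact hstart h1 h2
    refine ContinuousOn.if ?_ ?_ ?_
    · intro v hv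
      exact hmk v hv.1 (frontier_le_subset_eq (continuous_apply i) continuous_const hv.2)
    · rwa [(isClosed_le (continuous_apply i) continuous_const).closure_eq]
    · refine hc2.mono (inter_subset_inter_right _ ?_)
      refine closure_minimal ?_ (isClosed_le continuous_const (continuous_apply i))
      intro v hv
      exact (not_le.1 hv).le
  · rintro z (hz | hz)
    · have hz0 := (polygon_bounds z.2 i).1
      simp only [if_pos hz]
      have hback' : (z : Plane) + shift i n - shift i n = z := by abel
      rcases hz0.eq_or_lt with h | h
      · have hs : (z : Plane) ∈ startEdge i n := ⟨h.symm, hz.2⟩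
        have he := startEdge_add_shift hs
        rw [if_pos he.1.le, hmk _ ⟨by rw [he.1]; norm_num, he.2⟩ he.1, hback']
        exact mk'_of_mem z.2
      · rw [if_neg, hback']
        · exact mk'_of_mem z.2
        · rw [Pi.add_apply, shift_self]; linarith
    · have hz1 := (polygon_bounds z.2 i).2
      simp only [if_neg (hdisj hz), if_pos hz1]
      exact mk'_of_mem z.2
  · intro v hv
    by_cases h : v i ≤ 1
    · have he : v ∈ endPart i n := ⟨hv.1.1, hv.2⟩
      refine ⟨⟨v, hend he h⟩, Or.inr he, ?_, ?_⟩
      · simp only [if_pos h]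
        exact mk'_of_mem _
      · exact if_neg (hdisj he)
    · obtain ⟨h1, h2⟩ := hback v hv (not_le.1 h).le
      refine ⟨⟨v - shift i n, hstart h1 h2⟩, Or.inl h1, ?_, ?_⟩
      · simp only [if_neg h]
        exact mk'_of_mem _
      · simp only [if_pos h1]
        abel

/-- The translation atlas of the Chamanara surface. -/
def atlas : TranslationAtlas Chamanara where
  charts := charts
  exists_chart := by
    rintro ⟨z, hz | hz⟩
    · obtain ⟨φ, hφ, h⟩ := exists_chart_openSquare
      exact ⟨φ, hφ, h ⟨z, Or.inl hz⟩ hz⟩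
    · obtain ⟨i, hz'⟩ := mem_iUnion.1 hz
      obtain ⟨n, hz''⟩ := mem_iUnion.1 hz'
      obtain ⟨φ, hφ, h⟩ := exists_chart_edge i n
      exact ⟨φ, hφ, h ⟨z, Or.inr hz⟩ hz''⟩
  transition := charts_transition

end Chamanara

end

/-! Attach to each point `x` of a translation surface the set `star x` of vectors `v` for which the
straight line from `x` with velocity `v` survives up to time 1. Two facts are general. An affine
homeomorphism with derivative `A` maps `star x` onto `star` of the image by `A`
(`HasDerivative.mem_star_iff`). A covering preserves stars, because lines project and lift
(`star_pullback`).

The fact special to the Chamanara surface is `star_injective`: distinct points have distinct stars,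
since the removed corners and side midpoints block different vectors. Hence for an affine `f` on a
covering `p`, the star of `p (f y)` is `A` applied to the star of `p y`, so `p (f y)` depends only
on `p y` and `f` descends. If `A = 1`, the two stars are equal, so `p (f y) = p y`: translations are
deck transformations.

Injectivity rests on `add_mem_polygon_of_mem_star`: while the planar segment stays in the closed
square, a line on the surface must follow it, so the segment cannot end at a removed point. -/

open scoped unitInterval

/-! ### Straight lines under affine maps and coverings -/

section Lines

variable {S T : Type*} [TopologicalSpace S] [TopologicalSpace T]

namespace TranslationAtlas

/-- The path `γ` is a straight line of constant velocity `v` in the charts of `𝒜`. -/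
def IsLine (𝒜 : TranslationAtlas S) (γ : C(I, S)) (v : Plane) : Prop :=
  ∀ t, ∀ φ ∈ 𝒜.charts, γ t ∈ φ.source →
    ∀ᶠ s in 𝓝 t, φ (γ s) = φ (γ t) + ((s : ℝ) - t) • v

/-- The vectors `v` for which the straight line of velocity `v` from `x` exists up to time `1`. -/
def star (𝒜 : TranslationAtlas S) (x : S) : Set Plane :=
  {v | ∃ γ : C(I, S), 𝒜.IsLine γ v ∧ γ 0 = x}

theorem HasDerivative.mulVec_mem_star {𝒜 : TranslationAtlas S} {f : S ≃ₜ S}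
    {A : Matrix (Fin 2) (Fin 2) ℝ} (hf : 𝒜.HasDerivative f A) {x : S} {v : Plane}
    (hv : v ∈ 𝒜.star x) : A.mulVec v ∈ 𝒜.star (f x) := by
  obtain ⟨γ, hγ, h0⟩ := hv
  refine ⟨(f : C(S, S)).comp γ, ?_, congrArg f h0⟩
  intro t ψ hψ ht
  obtain ⟨φ, hφ, hx⟩ := 𝒜.exists_chart (γ t)
  obtain ⟨c, hc⟩ := hf φ hφ ψ hψ (γ t) hx ht
  filter_upwards [hγ t φ hφ hx, γ.continuous.continuousAt.eventually hc] with s h1 h2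
  change ψ (f (γ s)) = ψ (f (γ t)) + _
  rw [h2, hc.self_of_nhds, h1, Matrix.mulVec_add, Matrix.mulVec_smul]
  abel

theorem HasDerivative.mem_star_iff {𝒜 : TranslationAtlas S} {f : S ≃ₜ S} {A : GL (Fin 2) ℝ}
    (hf : 𝒜.HasDerivative f (A : Matrix (Fin 2) (Fin 2) ℝ)) (x : S) (v : Plane) :
    v ∈ 𝒜.star (f x) ↔ ((A⁻¹ : GL (Fin 2) ℝ) : Matrix (Fin 2) (Fin 2) ℝ).mulVec v ∈ 𝒜.star x := by
  constructor
  · intro h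
    have := hf.inv.mulVec_mem_star h
    rwa [Homeomorph.inv_apply, f.symm_apply_apply] at this
  · intro h
    have := hf.mulVec_mem_star h
    rwa [Matrix.mulVec_mulVec, Units.mul_inv, Matrix.one_mulVec] at this

/-- A chart of the pullback is a chart of `𝒜` after `p`, so a path upstairs is a line exactly when
its projection is one. Path lifting for coverings supplies the line upstairs on the whole of `I`. -/
theorem star_pullback (𝒜 : TranslationAtlas S) {p : T → S} (hp : IsCoveringMap p) (y : T) :
    (𝒜.pullback hp.isLocalHomeomorph).star y = 𝒜.star (p y) := by
  ext v
  constructor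
  · rintro ⟨Γ, hΓ, h0⟩
    refine ⟨(⟨p, hp.continuous⟩ : C(T, S)).comp Γ, ?_, congrArg p h0⟩
    intro t φ hφ ht
    obtain ⟨e, hx, he⟩ := hp.isLocalHomeomorph (Γ t)
    have := hΓ t (e.trans φ) ⟨e, φ, hφ, he, rfl⟩ (by
      rw [OpenPartialHomeomorph.trans_source]
      exact ⟨hx, by rw [mem_preimage, ← he]; exact ht⟩)
    simpa [← he] using this
  · rintro ⟨γ, hγ, h0⟩
    have hlift := congrFun (hp.liftPath_lifts γ y h0)
    refine ⟨hp.liftPath γ y h0, ?_, hp.liftPath_zero γ y h0⟩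
    rintro t _ ⟨e, φ, hφ, he, rfl⟩ ht
    rw [OpenPartialHomeomorph.trans_source] at ht
    have h1 : γ t ∈ φ.source := by
      have := ht.2
      rw [mem_preimage, ← he] at this
      rw [← hlift t]
      exact this
    filter_upwards [hγ t φ hφ h1] with s hs
    rw [OpenPartialHomeomorph.trans_apply, OpenPartialHomeomorph.trans_apply, ← he]
    rw [← hlift s, ← hlift t] at hs
    exact hs

/-- Since `p ∘ f = p`, a deck transformation read in charts of the pullback is a transition map of
`𝒜`. -/
theorem deckGroup_le_trans (𝒜 : TranslationAtlas S) {p : T → S} (hp : IsLocalHomeomorph p) :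
    deckGroup p ≤ (𝒜.pullback hp).trans := by
  rintro f hf _ ⟨e, φ, hφ, he, rfl⟩ _ ⟨e', φ', hφ', he', rfl⟩ x hx hx'
  rw [OpenPartialHomeomorph.trans_source] at hx hx'
  have h1 : p x ∈ φ.source := by have := hx.2; rwa [mem_preimage, ← he] at this
  have h2 : p x ∈ φ'.source := by
    have := hx'.2
    rwa [mem_preimage, ← he', hf x] at this
  obtain ⟨c, hc⟩ := 𝒜.transition φ hφ φ' hφ' (p x) h1 h2
  refine ⟨c, ?_⟩
  filter_upwards [hp.continuous.continuousAt.eventually hc] with y hy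
  rw [OpenPartialHomeomorph.trans_apply, OpenPartialHomeomorph.trans_apply, ← he, ← he', hf y,
    Matrix.one_mulVec]
  exact hy

theorem HasDerivative.of_semiconj {𝒜 : TranslationAtlas S} {p : T → S}
    (hp : IsLocalHomeomorph p) (hsurj : Function.Surjective p) {f : T → T} {g : S → S}
    {A : Matrix (Fin 2) (Fin 2) ℝ} (hf : (𝒜.pullback hp).HasDerivative f A)
    (hfg : ∀ y, p (f y) = g (p y)) : 𝒜.HasDerivative g A := by
  intro φ hφ ψ hψ x hx hx'
  obtain ⟨y, rfl⟩ := hsurj x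
  obtain ⟨e, hy, he⟩ := hp y
  obtain ⟨e', hy', he'⟩ := hp (f y)
  obtain ⟨c, hc⟩ := hf (e.trans φ) ⟨e, φ, hφ, he, rfl⟩ (e'.trans ψ) ⟨e', ψ, hψ, he', rfl⟩ y
    (by rw [OpenPartialHomeomorph.trans_source]
        exact ⟨hy, by rw [mem_preimage, ← he]; exact hx⟩)
    (by rw [OpenPartialHomeomorph.trans_source]
        exact ⟨hy', by rw [mem_preimage, ← he', hfg]; exact hx'⟩)
  refine ⟨c, ?_⟩
  rw [← hp.map_nhds_eq y, eventually_map]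
  filter_upwards [hc] with z hz
  rwa [OpenPartialHomeomorph.trans_apply, OpenPartialHomeomorph.trans_apply, ← he, ← he', hfg]
    at hz

end TranslationAtlas

/-! ### Surjectivity of coverings and descent of homeomorphisms -/

theorem IsCoveringMap.surjective_of_pathConnectedSpace [PathConnectedSpace S] [Nonempty T]
    {p : T → S} (hp : IsCoveringMap p) : Function.Surjective p := by
  intro x
  obtain ⟨y⟩ := ‹Nonempty T›
  let γ := PathConnectedSpace.somePath (p y) x
  refine ⟨hp.liftPath γ y γ.source 1, ?_⟩
  exact (congrFun (hp.liftPath_lifts γ y γ.source) 1).trans γ.target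

/-- A homeomorphism that maps fibres of a quotient map to fibres, in both directions, descends. -/
theorem Homeomorph.exists_semiconj {p : T → S} (hp : IsQuotientMap p) (f : T ≃ₜ T)
    (hf : ∀ y y', p y = p y' → p (f y) = p (f y'))
    (hf' : ∀ y y', p y = p y' → p (f.symm y) = p (f.symm y')) :
    ∃ g : S ≃ₜ S, ∀ y, p (f y) = g (p y) := by
  have key : ∀ h : T ≃ₜ T, (∀ y y', p y = p y' → p (h y) = p (h y')) →
      ∃ g : S → S, Continuous g ∧ ∀ y, g (p y) = p (h y) := by
    intro h hh
    -- The choice of preimage is immaterial, because `h` maps fibres into fibres.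
    refine ⟨fun x => p (h (Function.surjInv hp.surjective x)), ?_, fun y =>
      hh _ _ (Function.surjInv_eq hp.surjective _)⟩
    rw [hp.continuous_iff]
    refine (hp.continuous.comp h.continuous).congr fun y => ?_
    exact hh _ _ (Function.surjInv_eq hp.surjective _).symm
  obtain ⟨g, hg, hgp⟩ := key f hf
  obtain ⟨g', hg', hgp'⟩ := key f.symm hf'
  refine ⟨⟨⟨g, g', ?_, ?_⟩, hg, hg'⟩, fun y => (hgp y).symm⟩
  · intro x
    obtain ⟨y, rfl⟩ := hp.surjective x
    rw [hgp, hgp', f.symm_apply_apply]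
  · intro x
    obtain ⟨y, rfl⟩ := hp.surjective x
    rw [hgp', hgp, f.apply_symm_apply]

end Lines

namespace Chamanara

/-! ### The polygon near its boundary segments -/

/-- The closed unit square. -/
def closedSquare : Set Plane := {z | ∀ j, z j ∈ Icc (0 : ℝ) 1}

theorem convex_closedSquare : Convex ℝ closedSquare := by
  intro z hz w hw a b ha hb hab j
  exact convex_Icc (0 : ℝ) 1 (hz j) (hw j) ha hb hab

theorem polygon_subset_closedSquare : polygon ⊆ closedSquare := fun _ hz j => polygon_bounds hz j

theorem mem_polygon_of_mem_startPart {i : Fin 2} {n : ℕ} {z : Plane} (hz : z ∈ startPart i n)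
    (h : 0 ≤ z i) : z ∈ polygon := by
  obtain ⟨p0, p1, p2, p3⟩ := pow_facts n
  rcases h.eq_or_lt with h | h
  · exact startEdge_subset i n ⟨h.symm, hz.2⟩
  · exact Or.inl ((mem_openSquare i).2 ⟨⟨h, by linarith [hz.1]⟩,
      by linarith [hz.2.1], by linarith [hz.2.2]⟩)

theorem mem_polygon_of_mem_endPart {i : Fin 2} {n : ℕ} {z : Plane} (hz : z ∈ endPart i n)
    (h : z i ≤ 1) : z ∈ polygon := by
  obtain ⟨p0, p1, p2, p3⟩ := pow_facts n
  rcases h.eq_or_lt with h | h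
  · exact endEdge_subset i n ⟨h, hz.2⟩
  · exact Or.inl ((mem_openSquare i).2 ⟨⟨by linarith [hz.1], h⟩,
      by linarith [hz.2.1], by linarith [hz.2.2]⟩)

theorem startEdge_subset_startPart (i : Fin 2) (n : ℕ) : startEdge i n ⊆ startPart i n :=
  fun _ hz => ⟨by rw [hz.1]; norm_num, hz.2⟩

theorem endEdge_subset_endPart (i : Fin 2) (n : ℕ) : endEdge i n ⊆ endPart i n :=
  fun _ hz => ⟨by rw [hz.1]; norm_num, hz.2⟩

/-- The polygon is relatively open in the closed square. -/
theorem eventually_mem_polygon {z : Plane} (hz : z ∈ polygon) :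
    ∀ᶠ w in 𝓝 z, w ∈ closedSquare → w ∈ polygon := by
  rcases hz with hz | hz
  · filter_upwards [isOpen_openSquare.mem_nhds hz] with w hw _ using Or.inl hw
  · obtain ⟨i, hz⟩ := mem_iUnion.1 hz
    obtain ⟨n, hz | hz⟩ := mem_iUnion.1 hz
    · filter_upwards [(isOpen_startPart i n).mem_nhds (startEdge_subset_startPart i n hz)]
        with w hw h using mem_polygon_of_mem_startPart hw (h i).1
    · filter_upwards [(isOpen_endPart i n).mem_nhds (endEdge_subset_endPart i n hz)]
        with w hw h using mem_polygon_of_mem_endPart hw (h i).2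

theorem sub_shift_mem_startEdge {i : Fin 2} {n : ℕ} {z : Plane} (hz : z ∈ endEdge i n) :
    z - shift i n ∈ startEdge i n := by
  obtain ⟨h0, h1, h2⟩ := hz
  obtain ⟨p0, p1, p2, p3⟩ := pow_facts n
  refine ⟨by simp [h0, shift_self], ?_, ?_⟩ <;>
  · rw [Pi.sub_apply, shift_other]
    linarith

theorem not_mem_startPart_of_mem_endPart {i : Fin 2} {n : ℕ} {z : Plane} (h : z ∈ endPart i n) :
    z ∉ startPart i n := fun h' => absurd (h.1.trans h'.1) (lt_irrefl _)

/-- Next to the two segments with index `(i, n)`, only these two segments are glued. -/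
theorem Glue.mem_startEdge {i : Fin 2} {n : ℕ} {z w : polygon} (hg : Glue z w)
    (h : (z : Plane) ∈ startPart i n ∪ endPart i n ∨ (w : Plane) ∈ startPart i n ∪ endPart i n) :
    (z : Plane) ∈ startEdge i n ∧ (w : Plane) = z + shift i n := by
  obtain ⟨p0, p1, p2, p3⟩ := pow_facts n
  obtain ⟨j, m, hz, hw⟩ := hg
  have hw' : (w : Plane) ∈ endEdge j m := hw ▸ startEdge_add_shift hz
  have hb : ∀ {v : Plane}, v ∈ startPart i n ∪ endPart i n → v (1 - i) ∈ Ioo (0 : ℝ) 1 := by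
    rintro v (hv | hv)
    · exact ⟨by linarith [hv.2.1], by linarith [hv.2.2]⟩
    · exact ⟨by linarith [hv.2.1], by linarith [hv.2.2]⟩
  rcases eq_or_eq i j with rfl | rfl
  · have hmn : m = n := by
      rcases h with (h | h) | (h | h)
      · have h1 := hz.2
        have h2 := h.2
        refine index_unique (t := 1 - (z : Plane) (1 - j)) ?_ ?_
        · exact ⟨by linarith [h1.2], by linarith [h1.1]⟩
        · exact ⟨by linarith [h2.2], by linarith [h2.1]⟩
      · have := h.1
        rw [hz.1] at this
        norm_num at this
      · have := h.1
        rw [hw'.1] at this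
        norm_num at this
      · exact index_unique hw'.2 h.2
    subst hmn
    exact ⟨hz, hw⟩
  · rcases h with h | h
    · exact absurd hz.1 (hb h).1.ne'
    · exact absurd hw'.1 (hb h).2.ne

/-! ### Closedness of the graph of the projection -/

theorem exists_isOpen_of_saturated {E : Set polygon} (hE : IsOpen E)
    (hsat : ∀ z w, Glue z w → (z ∈ E ↔ w ∈ E)) :
    ∃ U : Set Chamanara, IsOpen U ∧ ∀ z, mk z ∈ U ↔ z ∈ E := by
  let E' : Chamanara → Prop := Quot.lift (fun z => z ∈ E) fun z w h => propext (hsat z w h)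
  exact ⟨{x | E' x}, isOpen_iff.2 hE, fun _ => Iff.rfl⟩

/-- The fibre of `mk z` consists of `z` and `z + shift i n`. A point `w` of the plane different from
both is separated from both, and a small saturated neighbourhood of the fibre then stays away from
`w`. -/
theorem mk_eq_of_frequently_of_mem_startEdge {i : Fin 2} {n : ℕ} {z : polygon}
    (hz : (z : Plane) ∈ startEdge i n) {w : Plane}
    (h : ∀ U ∈ 𝓝 (mk z), ∀ V ∈ 𝓝 w, ∃ a : polygon, (a : Plane) ∈ V ∧ mk a ∈ U) :
    ∃ hw : w ∈ polygon, mk ⟨w, hw⟩ = mk z := by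
  by_cases h1 : w = z
  · exact ⟨h1 ▸ z.2, congrArg mk (Subtype.ext h1)⟩
  by_cases h2 : w = z + shift i n
  · exact ⟨h2 ▸ endEdge_subset i n (startEdge_add_shift hz), (Quot.sound ⟨i, n, hz, h2⟩).symm⟩
  exfalso
  obtain ⟨v₁, u₁, hv₁, hu₁, hw₁, hz₁, d₁⟩ := t2_separation h1
  obtain ⟨v₂, u₂, hv₂, hu₂, hw₂, hz₂, d₂⟩ := t2_separation h2
  -- Each of `P` and `P'` also carries the other's constraint, transported by the shift; this makes
  -- the union saturated under the gluing.
  let P : Set Plane := startPart i n ∩ (u₁ ∩ (· + shift i n) ⁻¹' u₂)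
  let P' : Set Plane := endPart i n ∩ (u₂ ∩ (· - shift i n) ⁻¹' u₁)
  have hP : IsOpen P := (isOpen_startPart i n).inter (hu₁.inter (hu₂.preimage (by fun_prop)))
  have hP' : IsOpen P' := (isOpen_endPart i n).inter (hu₂.inter (hu₁.preimage (by fun_prop)))
  obtain ⟨U, hU, hUE⟩ := exists_isOpen_of_saturated
    (E := {a : polygon | (a : Plane) ∈ P ∪ P'}) ((hP.union hP').preimage continuous_subtype_val) (by
      intro a b hab
      constructor
      · intro ha
        obtain ⟨s1, s2⟩ := hab.mem_startEdge (i := i) (n := n)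
          (Or.inl (ha.imp And.left And.left))
        rcases ha with ha | ha
        · refine Or.inr ⟨?_, ?_, ?_⟩
          · rw [s2]; exact endEdge_subset_endPart i n (startEdge_add_shift s1)
          · rw [s2]; exact ha.2.2
          · rw [s2, mem_preimage, add_sub_cancel_right]; exact ha.2.1
        · exact absurd (startEdge_subset_startPart i n s1) (not_mem_startPart_of_mem_endPart ha.1)
      · intro hb
        obtain ⟨s1, s2⟩ := hab.mem_startEdge (i := i) (n := n)
          (Or.inr (hb.imp And.left And.left))
        have s3 := endEdge_subset_endPart i n (startEdge_add_shift s1)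
        rcases hb with hb | hb
        · rw [s2] at hb
          exact absurd hb.1 (not_mem_startPart_of_mem_endPart s3)
        · rw [s2] at hb
          refine Or.inl ⟨startEdge_subset_startPart i n s1, ?_, hb.2.1⟩
          have := hb.2.2
          rwa [mem_preimage, add_sub_cancel_right] at this)
  obtain ⟨a, ha, haU⟩ := h U
    (hU.mem_nhds ((hUE z).2 (Or.inl ⟨startEdge_subset_startPart i n hz, hz₁, hz₂⟩)))
    (v₁ ∩ v₂) (inter_mem (hv₁.mem_nhds hw₁) (hv₂.mem_nhds hw₂))
  rcases (hUE a).1 haU with h' | h'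
  · exact disjoint_left.1 d₁ ha.1 h'.2.1
  · exact disjoint_left.1 d₂ ha.2 h'.2.1

/-- The graph of the projection is closed in the product of the plane and the surface. -/
theorem mk_eq_of_frequently {x : Chamanara} {w : Plane}
    (h : ∀ U ∈ 𝓝 x, ∀ V ∈ 𝓝 w, ∃ a : polygon, (a : Plane) ∈ V ∧ mk a ∈ U) :
    ∃ hw : w ∈ polygon, mk ⟨w, hw⟩ = x := by
  obtain ⟨z, hz⟩ := x
  change ∃ hw : w ∈ polygon, mk ⟨w, hw⟩ = mk ⟨z, hz⟩
  replace h : ∀ U ∈ 𝓝 (mk ⟨z, hz⟩), ∀ V ∈ 𝓝 w, ∃ a : polygon, (a : Plane) ∈ V ∧ mk a ∈ U := h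
  rcases id hz with hz' | hz'
  · by_cases h1 : w = z
    · exact ⟨h1 ▸ hz, congrArg mk (Subtype.ext h1)⟩
    exfalso
    obtain ⟨v, u, hv, hu, hwv, hzu, d⟩ := t2_separation h1
    obtain ⟨U, hU, hUE⟩ := exists_isOpen_of_saturated
      (E := {a : polygon | (a : Plane) ∈ openSquare ∩ u})
      ((isOpen_openSquare.inter hu).preimage continuous_subtype_val) (fun a b hab =>
        ⟨fun ha => absurd ha.1 (not_mem_openSquare_of_glue hab).1,
          fun hb => absurd hb.1 (not_mem_openSquare_of_glue hab).2⟩)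
    obtain ⟨a, ha, haU⟩ := h U (hU.mem_nhds ((hUE _).2 ⟨hz', hzu⟩)) v (hv.mem_nhds hwv)
    exact disjoint_left.1 d ha ((hUE a).1 haU).2
  · obtain ⟨i, hz'⟩ := mem_iUnion.1 hz'
    obtain ⟨n, hz' | hz'⟩ := mem_iUnion.1 hz'
    · exact mk_eq_of_frequently_of_mem_startEdge hz' h
    · have hs : z - shift i n ∈ startEdge i n := sub_shift_mem_startEdge hz'
      have he : mk ⟨z - shift i n, startEdge_subset i n hs⟩ = mk ⟨z, hz⟩ :=
        Quot.sound ⟨i, n, hs, (sub_add_cancel _ _).symm⟩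
      rw [← he] at h ⊢
      exact mk_eq_of_frequently_of_mem_startEdge hs h

/-! ### Lines on the Chamanara surface and segments in the square -/

/-- A line on the surface cannot leave the polygon through a singular point. -/
theorem add_mem_polygon_of_mem_star {z : polygon} {v : Plane} (hv : v ∈ atlas.star (mk z))
    (h : (z : Plane) + v ∈ closedSquare) : (z : Plane) + v ∈ polygon := by
  obtain ⟨γ, hγ, h0⟩ := hv
  let ℓ : I → Plane := fun t => z + (t : ℝ) • v
  have hℓ : Continuous ℓ := by fun_prop
  have hℓc : ∀ t, ℓ t ∈ closedSquare := by
    intro t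
    exact convex_closedSquare.add_smul_mem (polygon_subset_closedSquare z.2) h t.2
  -- The times at which the planar segment lies in the polygon and projects to the line.
  -- Connectedness of `I` gives all times, including `t = 1`.
  let A : Set I := {t | ∃ ht : ℓ t ∈ polygon, mk ⟨ℓ t, ht⟩ = γ t}
  have hA : IsClopen A := by
    constructor
    -- Closed: the closed graph yields both `ℓ t ∈ polygon` and the equality in the limit. This is
    -- what excludes removed points.
    · rw [← closure_subset_iff_isClosed]
      intro t ht
      refine mk_eq_of_frequently fun U hU V hV => ?_
      obtain ⟨s, ⟨hsV, hsU⟩, hs, hsγ⟩ := mem_closure_iff_nhds.1 ht _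
        (inter_mem (hℓ.continuousAt.preimage_mem_nhds hV)
          (γ.continuous.continuousAt.preimage_mem_nhds hU))
      exact ⟨⟨ℓ s, hs⟩, hsV, by rw [hsγ]; exact hsU⟩
    -- Open: the polygon is relatively open in the closed square, and in a chart both paths move
    -- with velocity `v` from the same point.
    · rw [isOpen_iff_mem_nhds]
      rintro t ⟨ht, htγ⟩
      obtain ⟨φ, hφ, hx⟩ := atlas.exists_chart (γ t)
      obtain ⟨c, hc⟩ := hφ ⟨ℓ t, ht⟩ (by rw [htγ]; exact hx)
      have hc0 := hc.self_of_nhds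
      rw [htγ] at hc0
      have hsrc := continuous_mk.continuousAt.preimage_mem_nhds
        (x := (⟨ℓ t, ht⟩ : polygon)) (φ.open_source.mem_nhds (by rw [htγ]; exact hx))
      have hc' := hc.and hsrc
      rw [nhds_subtype_eq_comap, eventually_comap] at hc'
      filter_upwards [hℓ.continuousAt.eventually (eventually_mem_polygon ht),
        hℓ.continuousAt.eventually hc', hγ t φ hφ hx,
        γ.continuous.continuousAt.preimage_mem_nhds (φ.open_source.mem_nhds hx)]
        with s h1 h2 h3 h4
      have hs := h1 (hℓc s)
      obtain ⟨h5, h6⟩ := h2 ⟨ℓ s, hs⟩ rfl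
      refine ⟨hs, φ.injOn h6 h4 ?_⟩
      rw [h5, h3, hc0]
      simp only [ℓ, sub_smul]
      abel
  have h0A : (0 : I) ∈ A := by
    have : ℓ 0 = z := by simp [ℓ]
    refine ⟨this ▸ z.2, ?_⟩
    rw [h0]
    exact congrArg mk (Subtype.ext this)
  have h1A : (1 : I) ∈ A := (hA.eq_univ ⟨0, h0A⟩) ▸ mem_univ _
  simpa [ℓ] using h1A.1

/-- By convexity the segment from `z` to `w` lies in the open square at all positive times, so its
projection is the required line. -/
theorem exists_isLine {z w : Plane} (hz : z ∈ polygon) (hw : w ∈ openSquare) :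
    ∃ γ : C(I, Chamanara), atlas.IsLine γ (w - z) ∧ γ 0 = mk ⟨z, hz⟩ ∧
      γ 1 = mk ⟨w, Or.inl hw⟩ := by
  have hmem : ∀ t : I, z + (t : ℝ) • (w - z) ∈ polygon := by
    intro t
    rcases t.2.1.eq_or_lt with h | h
    · rw [← h]; simpa using hz
    · left
      intro j
      have hzj := polygon_bounds hz j
      have hwj := hw j
      have ht := t.2.2
      simp only [Pi.add_apply, Pi.smul_apply, Pi.sub_apply, smul_eq_mul]
      constructor
      · nlinarith [mul_pos h hwj.1, mul_nonneg (sub_nonneg.2 ht) hzj.1]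
      · nlinarith [mul_pos h (sub_pos.2 hwj.2), mul_nonneg (sub_nonneg.2 ht) (sub_nonneg.2 hzj.2)]
  let ℓ : I → polygon := fun t => ⟨z + (t : ℝ) • (w - z), hmem t⟩
  have hℓ : Continuous ℓ := by fun_prop
  refine ⟨⟨fun t => mk (ℓ t), continuous_mk.comp hℓ⟩, ?_, ?_, ?_⟩
  · intro t φ hφ ht
    obtain ⟨c, hc⟩ := hφ (ℓ t) ht
    filter_upwards [hℓ.continuousAt.eventually hc] with s hs
    change φ (mk (ℓ s)) = φ (mk (ℓ t)) + _
    rw [hs, hc.self_of_nhds]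
    simp only [ℓ, sub_smul]
    abel
  · exact congrArg mk (Subtype.ext (by simp [ℓ]))
  · exact congrArg mk (Subtype.ext (by simp [ℓ]))

instance : PathConnectedSpace Chamanara := by
  have hc : (fun _ => 1 / 2 : Plane) ∈ openSquare := fun _ => by norm_num
  rw [pathConnectedSpace_iff_eq]
  refine ⟨mk ⟨_, Or.inl hc⟩, eq_univ_of_forall ?_⟩
  rintro ⟨z, hz⟩
  obtain ⟨γ, -, h0, h1⟩ := exists_isLine hz hc
  exact Joined.symm ⟨⟨γ, h0, h1⟩⟩

/-! ### Points are determined by their stars -/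

/-- Neither the corners of the square nor the midpoints of its sides belong to the polygon. -/
theorem not_mem_polygon {z : Plane} (h : ∀ j, z j = 0 ∨ z j = 1 / 2 ∨ z j = 1)
    (h' : ∃ j, z j ≠ 1 / 2) : z ∉ polygon := by
  rintro (hz | hz)
  · obtain ⟨j, hj⟩ := h'
    rcases h j with e | e | e
    · exact (hz j).1.ne' e
    · exact hj e
    · exact (hz j).2.ne e
  -- The midpoint of a side is the common end point of its two longest segments.
  · have key : ∀ n : ℕ, (1 : ℝ) / 2 ∉ Ioo (1 / 2 ^ (n + 1) : ℝ) (1 / 2 ^ n) := by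
      rintro n ⟨h1, h2⟩
      rcases n with _ | n
      · norm_num at h1
      · obtain ⟨-, p1, p2, -⟩ := pow_facts n
        linarith
    obtain ⟨i, hz⟩ := mem_iUnion.1 hz
    obtain ⟨n, hz | hz⟩ := mem_iUnion.1 hz
    · have hb := (mem_startEdge_bounds hz).2
      rcases h (1 - i) with e | e | e
      · exact hb.1.ne' e
      · have := hz.2
        rw [e] at this
        exact key n ⟨by linarith [this.2], by linarith [this.1]⟩
      · exact hb.2.ne e
    · have hb := (mem_endEdge_bounds hz).2
      rcases h (1 - i) with e | e | e
      · exact hb.1.ne' e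
      · exact key n (e ▸ hz.2)
      · exact hb.2.ne e

/-- The half-open range makes coordinates of two representatives differ by less than 1, as needed to
keep the target in `star_injective` inside the open square. -/
theorem exists_representative (x : Chamanara) :
    ∃ z : polygon, mk z = x ∧ ∀ j, (z : Plane) j ∈ Ico (0 : ℝ) 1 := by
  obtain ⟨z, hz⟩ := x
  rcases id hz with hz' | hz'
  · exact ⟨⟨z, hz⟩, rfl, fun j => ⟨(hz' j).1.le, (hz' j).2⟩⟩
  · have key : ∀ {i n} {a : Plane}, a ∈ startEdge i n → ∀ j, a j ∈ Ico (0 : ℝ) 1 := by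
      intro i n a ha j
      obtain ⟨h1, h2⟩ := mem_startEdge_bounds ha
      rcases eq_or_eq i j with rfl | rfl
      · rw [h1]; norm_num
      · exact ⟨h2.1.le, h2.2⟩
    obtain ⟨i, hz'⟩ := mem_iUnion.1 hz'
    obtain ⟨n, hz' | hz'⟩ := mem_iUnion.1 hz'
    · exact ⟨⟨z, hz⟩, rfl, key hz'⟩
    · have hs : z - shift i n ∈ startEdge i n := sub_shift_mem_startEdge hz'
      exact ⟨⟨z - shift i n, startEdge_subset i n hs⟩,
        Quot.sound ⟨i, n, hs, (sub_add_cancel _ _).symm⟩, key hs⟩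

/-- A point of the surface is determined by the straight lines that start there. -/
theorem star_injective : Function.Injective atlas.star := by
  intro x x' hxx
  obtain ⟨z, rfl, hz⟩ := exists_representative x
  obtain ⟨z', rfl, hz'⟩ := exists_representative x'
  by_contra hne
  have hne' : (z : Plane) ≠ z' := fun h => hne (congrArg mk (Subtype.ext h))
  -- A removed point, chosen so that the vector `d - z'`, blocked at `z'`, leads from `z` into the
  -- open square. Coordinates that differ give 0 or 1; an equal coordinate gives 1/2, so `d` is a
  -- corner or a side midpoint.
  let d : Plane := fun j =>
    if (z : Plane) j < (z' : Plane) j then 1 else if (z' : Plane) j < (z : Plane) j then 0 else 1 / 2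
  have hd : ∀ j, d j = 0 ∨ d j = 1 / 2 ∨ d j = 1 := by
    intro j
    simp only [d]
    split_ifs <;> simp
  have hd' : ∃ j, d j ≠ 1 / 2 := by
    obtain ⟨j, hj⟩ := Function.ne_iff.1 hne'
    refine ⟨j, ?_⟩
    rcases hj.lt_or_gt with h | h
    · simp only [d, if_pos h]; norm_num
    · simp only [d, if_neg h.not_gt, if_pos h]; norm_num
  have hq : d - ((z' : Plane) - z) ∈ openSquare := by
    intro j
    have h1 := hz j
    have h2 := hz' j
    simp only [d, Pi.sub_apply]
    split_ifs with h3 h4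
    · exact ⟨by linarith [h1.1, h2.2], by linarith⟩
    · exact ⟨by linarith, by linarith [h1.2, h2.1]⟩
    · have : (z : Plane) j = (z' : Plane) j := le_antisymm (not_lt.1 h4) (not_lt.1 h3)
      rw [this]
      norm_num
  obtain ⟨γ, hγ, h0, -⟩ := exists_isLine z.2 hq
  -- Equality of the stars moves this vector to `z'`, where the line would have to end at `d`.
  have hmem : d - ((z' : Plane) - z) - z ∈ atlas.star (mk z') := hxx ▸ ⟨γ, hγ, h0⟩
  have hsum : (z' : Plane) + (d - ((z' : Plane) - z) - z) = d := by abel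
  have := add_mem_polygon_of_mem_star hmem (by
    rw [hsum]
    intro j
    rcases hd j with e | e | e <;> rw [e] <;> norm_num)
  rw [hsum] at this
  exact not_mem_polygon hd hd' this

/-! ### Affine maps and translations of coverings -/

variable {Y : Type*} [TopologicalSpace Y] {p : Y → Chamanara}

/-- The star of `p (f y)` is the image under `A` of the star of `p y`, hence depends only on `p y`.
-/
theorem map_eq_of_hasDerivative (hp : IsCoveringMap p) {f : Y ≃ₜ Y} {A : GL (Fin 2) ℝ}
    (hf : (atlas.pullback hp.isLocalHomeomorph).HasDerivative f
      (A : Matrix (Fin 2) (Fin 2) ℝ)) {y y' : Y} (h : p y = p y') : p (f y) = p (f y') := by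
  apply star_injective
  ext v
  rw [← atlas.star_pullback hp, ← atlas.star_pullback hp, hf.mem_star_iff, hf.mem_star_iff,
    atlas.star_pullback hp, atlas.star_pullback hp, h]

theorem exists_descent [Nonempty Y] (hp : IsCoveringMap p) {f : Y ≃ₜ Y} {A : GL (Fin 2) ℝ}
    (hf : (atlas.pullback hp.isLocalHomeomorph).HasDerivative f
      (A : Matrix (Fin 2) (Fin 2) ℝ)) :
    ∃ g : Chamanara ≃ₜ Chamanara, atlas.HasDerivative g (A : Matrix (Fin 2) (Fin 2) ℝ) ∧
      ∀ y, p (f y) = g (p y) := by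
  have hsurj := hp.surjective_of_pathConnectedSpace
  obtain ⟨g, hg⟩ := f.exists_semiconj
    (hp.isLocalHomeomorph.isOpenMap.isQuotientMap hp.continuous hsurj)
    (fun _ _ h => map_eq_of_hasDerivative hp hf h)
    -- The inverse of `f` is affine too, so it also preserves fibres and the descended map is a
    -- homeomorphism.
    (fun _ _ h => map_eq_of_hasDerivative hp hf.inv h)
  exact ⟨g, hf.of_semiconj hp.isLocalHomeomorph hsurj hg, hg⟩

theorem trans_pullback (hp : IsCoveringMap p) :
    (atlas.pullback hp.isLocalHomeomorph).trans = deckGroup p := by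
  refine le_antisymm ?_ (atlas.deckGroup_le_trans hp.isLocalHomeomorph)
  intro f hf y
  apply star_injective
  ext v
  rw [← atlas.star_pullback hp,
    TranslationAtlas.HasDerivative.mem_star_iff (A := 1) (by rw [Units.val_one]; exact hf) y v,
    atlas.star_pullback hp]
  simp

end Chamanara

theorem mainTheorem5 :
    (∀ {Y : Type*} [TopologicalSpace Y] [ConnectedSpace Y] (p : Y → Chamanara)
      (hp : IsCoveringMap p),
      (∀ f ∈ (Chamanara.atlas.pullback hp.isLocalHomeomorph).aff,
        ∃ g ∈ Chamanara.atlas.aff, ∀ y, p (f y) = g (p y)) ∧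
      (Chamanara.atlas.pullback hp.isLocalHomeomorph).veechGroup ≤ Chamanara.atlas.veechGroup) ∧
    (∀ {Z : Type*} [TopologicalSpace Z] [SimplyConnectedSpace Z] (q : Z → Chamanara)
      (hq : IsCoveringMap q),
      (Chamanara.atlas.pullback hq.isLocalHomeomorph).trans = deckGroup q) := by
  refine ⟨fun p hp => ⟨?_, ?_⟩, fun q hq => Chamanara.trans_pullback hq⟩
  · rintro f ⟨A, hf⟩
    obtain ⟨g, hg, h⟩ := Chamanara.exists_descent hp hf
    exact ⟨g, ⟨A, hg⟩, h⟩
  · rintro A ⟨f, hf⟩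
    obtain ⟨g, hg, -⟩ := Chamanara.exists_descent hp hf
    exact ⟨g, hg⟩
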